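/- Let $\gamma\in[0,1]$ and put \[ p=\frac{1/e}{1-(1-1/e)\gamma}\in[1/e,1]. \] An instance $I=(F_1,\dots,F_n)$, $n\ge 1$, consists of probability distributions on $[0,\infty)$ with finite expectations; $X_i\sim F_i$ are independent, and $\mathbb{E}[\mathrm{OPT}(I)]=\mathbb{E}[\max_i X_i]$. In the $\gamma$-prophet inequality with random order, the values are observed in the order $X_{\pi(1)},\dots,X_{\pi(n)}$, where $\pi$ is a uniformly random permutation independent of the values. An algorithm that stops at step $\tau$ has the reward $\mathrm{ALG}^\gamma=\max\{X_{\pi(\tau)},\gamma X_{\pi(\tau-1)},\dots,\gamma X_{\pi(1)}\}$ if $\tau\le n$, and $\mathrm{ALG}^\gamma=\gamma\max_i X_i$ if it never stops. Its competitive ratio over a class of instances is the infimum of $\mathbb{E}[\mathrm{ALG}^\gamma(I)]/\mathbb{E}[\mathrm{OPT}(I)]$ over the instances $I$ of the class with $\mathbb{E}[\mathrm{OPT}(I)]\ne 0$. The single-threshold algorithm with threshold $\theta=\theta(I)\in[0,\infty]$ stops at the first observed value that is larger than $\theta$. For every instance with continuous (atomless) distributions there is a threshold $\theta\in[0,\infty]$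 with $\Pr(\max_i X_i\le\theta)=p$. Moreover, for every class of instances (for example, all instances with continuous distributions), the single-threshold algorithm whose threshold satisfies \[ \Pr\Big(\max_{i} X_i\le\theta(I)\Big)=\frac{1/e}{1-(1-1/e)\gamma} \] on every instance $I$ of the class has a competitive ratio over that class of at least \[ 1-\frac{(1-\gamma)/e}{1-(1-1/e)\gamma}. \] -/

import Mathlib

open MeasureTheory
open scoped NNReal ENNReal Nat

noncomputable section

namespace LookbackProphet

/-- An instance: a tuple of `n ≥ 1` probability distributions on `[0, ∞)` with finite
expectations. -/
structure Instance where
  n : ℕ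
  pos : 0 < n
  F : Fin n → Measure ℝ≥0
  prob : ∀ i, IsProbabilityMeasure (F i)
  finiteMean : ∀ i, ∫⁻ x, (x : ℝ≥0∞) ∂(F i) ≠ ∞

namespace Instance

/-- The joint law of independent values `X_i ∼ F_i`. -/
def law (I : Instance) : Measure (Fin I.n → ℝ≥0) :=
  haveI := I.prob
  Measure.pi I.F

/-- All the distributions of the instance are continuous (atomless). -/
def IsContinuous (I : Instance) : Prop := ∀ i x, I.F i {x} = 0

end Instance

/-- The value `max_i x_i` of the prophet. -/
def maxValue {n : ℕ} (x : Fin n → ℝ≥0) : ℝ≥0 := Finset.univ.sup x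

/-- `E[OPT(I)]`, the expected maximum. -/
def expectedOpt (I : Instance) : ℝ≥0∞ := ∫⁻ x, (maxValue x : ℝ≥0∞) ∂I.law

/-- `P(max_i X_i ≤ θ)`. -/
def probMaxLE (I : Instance) (θ : ℝ≥0∞) : ℝ :=
  I.law.real {x | (maxValue x : ℝ≥0∞) ≤ θ}

/-- An online algorithm is given by its stopping time. On the observed sequence `y 0, y 1, …`
it stops at (zero-based) step `stopTime I y`, where the value `n` means that it never stops;
whether it stops at a step depends only on the values observed up to and including that step. -/
structure OnlineAlgorithm where
  stopTime : (I : Instance) → (Fin I.n → ℝ≥0) → ℕ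
  stopTime_le : ∀ I y, stopTime I y ≤ I.n
  nonanticipating : ∀ (I : Instance) (y z : Fin I.n → ℝ≥0),
    (∀ j : Fin I.n, (j : ℕ) ≤ stopTime I y → y j = z j) → stopTime I z = stopTime I y
  measurable_stopTime : ∀ I, Measurable (stopTime I)

/-- The reward in the `γ`-prophet inequality when the sequence `y` is observed and one stops at
step `t`: the maximum of `y t` (if `t < n`) and of `γ * y i` over all `i < t`. -/
def reward (γ : ℝ≥0) {n : ℕ} (y : Fin n → ℝ≥0) (t : ℕ) : ℝ≥0 :=
  Finset.univ.sup fun i : Fin n =>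
    if (i : ℕ) < t then γ * y i else if (i : ℕ) = t then y i else 0

/-- `E[ALG^γ(I)]` in the random order model: the values are observed in the order
`X_{π(1)}, …, X_{π(n)}` with `π` a uniformly random permutation, independent of the values. -/
def expectedReward (γ : ℝ≥0) (A : OnlineAlgorithm) (I : Instance) : ℝ≥0∞ :=
  (∑ π : Equiv.Perm (Fin I.n),
    ∫⁻ x, (reward γ (x ∘ π) (A.stopTime I (x ∘ π)) : ℝ≥0∞) ∂I.law) / (I.n ! : ℝ≥0∞)

/-- The competitive ratio of `A` in the random order `γ`-prophet inequality over a class `C` of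
instances: the infimum of `E[ALG^γ(I)] / E[OPT(I)]` over all `I` in `C` for which the ratio is
defined, that is, `E[OPT(I)] ≠ 0`. -/
def competitiveRatio (γ : ℝ≥0) (C : Set Instance) (A : OnlineAlgorithm) : ℝ≥0∞ :=
  ⨅ I ∈ C, ⨅ _ : expectedOpt I ≠ 0, expectedReward γ A I / expectedOpt I

/-- The first step at which a value larger than `θ` is observed, or `n` if there is none. -/
def firstAbove (θ : ℝ≥0∞) {n : ℕ} (hn : 0 < n) (y : Fin n → ℝ≥0) : ℕ :=
  Finset.univ.inf' (Finset.univ_nonempty_iff.2 ⟨⟨0, hn⟩⟩)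
    fun i : Fin n => if θ < (y i : ℝ≥0∞) then (i : ℕ) else n

theorem firstAbove_le_of (θ : ℝ≥0∞) {n : ℕ} (hn : 0 < n) {y z : Fin n → ℝ≥0}
    (h : ∀ j : Fin n, (j : ℕ) ≤ firstAbove θ hn y → y j = z j) :
    firstAbove θ hn z ≤ firstAbove θ hn y := by
  obtain ⟨i, -, hi⟩ := Finset.exists_mem_eq_inf' (Finset.univ_nonempty_iff.2 ⟨⟨0, hn⟩⟩)
    (fun i : Fin n => if θ < (y i : ℝ≥0∞) then (i : ℕ) else n)
  change firstAbove θ hn y = _ at hi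
  refine (Finset.inf'_le _ (Finset.mem_univ i)).trans ?_
  by_cases hy : θ < (y i : ℝ≥0∞)
  · rw [if_pos hy] at hi
    have := h i hi.ge
    rw [← this, if_pos hy, hi]
  · rw [if_neg hy] at hi
    rw [hi]
    split_ifs
    · exact i.2.le
    · exact le_rfl

theorem firstAbove_le (θ : ℝ≥0∞) {n : ℕ} (hn : 0 < n) (y : Fin n → ℝ≥0) :
    firstAbove θ hn y ≤ n := by
  refine (Finset.inf'_le _ (Finset.mem_univ ⟨0, hn⟩)).trans ?_
  split_ifs
  · exact Nat.zero_le _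
  · exact le_rfl

theorem firstAbove_congr (θ : ℝ≥0∞) {n : ℕ} (hn : 0 < n) (y z : Fin n → ℝ≥0)
    (h : ∀ j : Fin n, (j : ℕ) ≤ firstAbove θ hn y → y j = z j) :
    firstAbove θ hn z = firstAbove θ hn y := by
  have h1 := firstAbove_le_of θ hn h
  exact le_antisymm h1 (firstAbove_le_of θ hn fun j hj => (h j (hj.trans h1)).symm)

theorem measurable_firstAbove (θ : ℝ≥0∞) {n : ℕ} (hn : 0 < n) :
    Measurable (firstAbove θ hn) := by
  have h : Measurable (Finset.univ.inf' (Finset.univ_nonempty_iff.2 ⟨⟨0, hn⟩⟩)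
      fun (i : Fin n) (y : Fin n → ℝ≥0) => if θ < (y i : ℝ≥0∞) then (i : ℕ) else n) := by
    refine Finset.inf'_induction _ _ (fun _ hf _ hg => hf.inf hg) fun i _ => ?_
    refine Measurable.ite ?_ measurable_const measurable_const
    exact measurableSet_lt measurable_const (measurable_pi_apply i).coe_nnreal_ennreal
  convert h using 1
  funext y
  exact (Finset.inf'_apply (C := fun _ : Fin n → ℝ≥0 => ℕ) (Finset.univ_nonempty_iff.2 ⟨⟨0, hn⟩⟩)
    (fun (i : Fin n) (y : Fin n → ℝ≥0) => if θ < (y i : ℝ≥0∞) then (i : ℕ) else n) y).symm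

/-- The single-threshold algorithm that, on the instance `I`, accepts the first value larger than
`θ I`. The threshold may be infinite, in which case nothing is accepted. -/
def singleThreshold (θ : Instance → ℝ≥0∞) : OnlineAlgorithm where
  stopTime I y := firstAbove (θ I) I.pos y
  stopTime_le I y := firstAbove_le (θ I) I.pos y
  nonanticipating I y z h := firstAbove_congr (θ I) I.pos y z h
  measurable_stopTime I := measurable_firstAbove (θ I) I.pos

/-- The number `(1/e) / (1 - (1 - 1/e) γ)`. -/
def rejectProb (γ : ℝ≥0) : ℝ :=
  (1 / Real.exp 1) / (1 - (1 - 1 / Real.exp 1) * (γ : ℝ))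

end LookbackProphet

end

namespace LookbackProphet

/-! ### Threshold stopping on a fixed vector of values, in uniformly random order -/

section Pathwise

/-! Write `p` for `rejectProb γ`, `c = 1 - (1 - γ) p` for the claimed ratio, `N` for the number of
values above `θ`, and `A = E[max; max ≤ θ]`. If `N > 0`, the accepted value is uniform among those
above `θ`, with mean `θ + ∑ (X_i - θ)⁺ / N`; if `N = 0`, lookback gives `γ max`. Hence E[ALG] ≥ γ A
+ θ (1 - p) + ∑ E[(X_i - θ)⁺ / N] (`le_expectedReward`), E[OPT] ≤ A + θ (1 - p) + ∑ E[(X_i - θ)⁺]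
(`expectedOpt_le`).

The excess terms are compared one by one. If `X_i > θ`, then `1/N = ∫₀¹ (1 - t)^(N-1) dt`, which
corresponds to independent uniform arrival times. Independence and weighted AM-GM, `q^t ≤ 1 - t + t
q`, bound the `i`-th term below by `E[(X_i - θ)⁺] ∫₀¹ p^t dt` (`mul_lintegral_rpow_le`). The
integral is `(1 - p) / (-log p)`, which is at least `c` (`ratio_le_div_neg_log`). The other terms
compare with factor `c` because `A ≤ θ p`. The case `γ = 1`, where `p = 1` and `log p = 0`, is
separate. -/

theorem maxValue_le_iff {n : ℕ} {x : Fin n → ℝ≥0} {θ : ℝ≥0∞} :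
    (maxValue x : ℝ≥0∞) ≤ θ ↔ ∀ i, (x i : ℝ≥0∞) ≤ θ := by
  induction θ using ENNReal.recTopCoe with
  | top => simp
  | coe θ => simp [maxValue]

theorem le_maxValue {n : ℕ} (x : Fin n → ℝ≥0) (i : Fin n) : x i ≤ maxValue x :=
  Finset.le_sup (f := x) (Finset.mem_univ i)

theorem measurable_finset_sup {α ι : Type*} [MeasurableSpace α] (s : Finset ι)
    {f : ι → α → ℝ≥0} (hf : ∀ i ∈ s, Measurable (f i)) :
    Measurable fun a => s.sup fun i => f i a := by
  have h : Measurable (s.sup f) :=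
    Finset.sup_induction measurable_const (fun _ hf _ hg => hf.sup hg) hf
  convert h using 1
  funext a
  exact (Finset.sup_apply s f a).symm

theorem measurable_maxValue {n : ℕ} : Measurable (maxValue : (Fin n → ℝ≥0) → ℝ≥0) := by
  exact measurable_finset_sup Finset.univ fun i _ => measurable_pi_apply i

theorem maxValue_comp_perm {n : ℕ} (x : Fin n → ℝ≥0) (π : Equiv.Perm (Fin n)) :
    maxValue (x ∘ π) = maxValue x := by
  apply le_antisymm
  · exact Finset.sup_le fun i _ => le_maxValue x (π i)
  · refine Finset.sup_le fun i _ => ?_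
    simpa using le_maxValue (x ∘ π) (π.symm i)

theorem firstAbove_congr_of_iff (θ : ℝ≥0∞) {n : ℕ} (hn : 0 < n) {y z : Fin n → ℝ≥0}
    (h : ∀ j, θ < (y j : ℝ≥0∞) ↔ θ < (z j : ℝ≥0∞)) :
    firstAbove θ hn y = firstAbove θ hn z := by
  simp only [firstAbove, h]

theorem exists_firstAbove_eq (θ : ℝ≥0∞) {n : ℕ} (hn : 0 < n) {y : Fin n → ℝ≥0}
    (h : ∃ i, θ < (y i : ℝ≥0∞)) :
    ∃ i : Fin n, (i : ℕ) = firstAbove θ hn y ∧ θ < (y i : ℝ≥0∞) := by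
  obtain ⟨i, -, hi⟩ := Finset.exists_mem_eq_inf' (Finset.univ_nonempty_iff.2 ⟨⟨0, hn⟩⟩)
    (fun i : Fin n => if θ < (y i : ℝ≥0∞) then (i : ℕ) else n)
  change firstAbove θ hn y = _ at hi
  by_cases hy : θ < (y i : ℝ≥0∞)
  · exact ⟨i, by rw [hi, if_pos hy], hy⟩
  · obtain ⟨j, hj⟩ := h
    have h1 : firstAbove θ hn y ≤ _ := Finset.inf'_le _ (Finset.mem_univ j)
    rw [if_pos hj, hi, if_neg hy] at h1
    exact absurd j.2 h1.not_gt

theorem firstAbove_eq_of_forall_le (θ : ℝ≥0∞) {n : ℕ} (hn : 0 < n) {y : Fin n → ℝ≥0}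
    (h : ∀ i, (y i : ℝ≥0∞) ≤ θ) : firstAbove θ hn y = n := by
  refine le_antisymm (firstAbove_le θ hn y) (Finset.le_inf' _ _ fun i _ => ?_)
  rw [if_neg (h i).not_gt]

theorem le_reward (γ : ℝ≥0) {n : ℕ} (y : Fin n → ℝ≥0) (i : Fin n) :
    y i ≤ reward γ y i := by
  refine le_trans ?_ (Finset.le_sup (Finset.mem_univ i))
  simp

theorem reward_of_never (γ : ℝ≥0) {n : ℕ} (y : Fin n → ℝ≥0) :
    reward γ y n = γ * maxValue y := by
  simp [reward, maxValue, NNReal.mul_finset_sup]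

theorem measurable_reward (γ : ℝ≥0) {n : ℕ} {t : (Fin n → ℝ≥0) → ℕ} (ht : Measurable t) :
    Measurable fun y : Fin n → ℝ≥0 => reward γ y (t y) := by
  unfold reward
  refine measurable_finset_sup _ fun i _ => ?_
  refine Measurable.ite (ht (measurableSet_Ioi (a := (i : ℕ)))) (by fun_prop) ?_
  exact Measurable.ite (measurableSet_eq_fun measurable_const ht) (by fun_prop) (by fun_prop)

/-- A random element of `S` whose law is invariant under the transpositions of `S` is uniform. -/
theorem card_mul_sum_perm_of_swap {n : ℕ} (S : Finset (Fin n)) (f : Equiv.Perm (Fin n) → Fin n)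
    (hf : ∀ π, f π ∈ S)
    (hswap : ∀ i ∈ S, ∀ j ∈ S, ∀ π, f (Equiv.swap i j * π) = Equiv.swap i j (f π))
    (g : Fin n → ℝ≥0) :
    (S.card : ℝ≥0) * ∑ π, g (f π) = (n ! : ℝ≥0) * ∑ i ∈ S, g i := by
  classical
  set c : Fin n → ℕ := fun i => (Finset.univ.filter fun π => f π = i).card with hc
  -- Left multiplication by the transposition of `i` and `j` is a bijection between the fibres of
  -- `f` over `i` and `j`.
  have hcc : ∀ i ∈ S, ∀ j ∈ S, c i = c j := by
    intro i hi j hj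
    refine Finset.card_bij (fun π _ => Equiv.swap i j * π) ?_ ?_ ?_
    · intro π hπ
      have : f π = i := by simpa using hπ
      simp [hswap i hi j hj, this]
    · intro a _ b _ h
      exact mul_left_cancel h
    · intro π hπ
      have : f π = j := by simpa using hπ
      exact ⟨Equiv.swap i j * π, by simp [hswap i hi j hj, this], by simp⟩
  have hcard : ∑ i ∈ S, c i = n ! := by
    rw [← Finset.card_eq_sum_card_fiberwise (fun π _ => hf π), Finset.card_univ,
      Fintype.card_perm, Fintype.card_fin]
  have hsum : ∑ π, g (f π) = ∑ i ∈ S, (c i : ℝ≥0) * g i := by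
    rw [← Finset.sum_fiberwise_of_maps_to (s := Finset.univ) (fun π _ => hf π)]
    refine Finset.sum_congr rfl fun i _ => ?_
    rw [Finset.sum_congr rfl fun π hπ => by rw [(Finset.mem_filter.1 hπ).2], Finset.sum_const,
      nsmul_eq_mul]
  rw [hsum, Finset.mul_sum, Finset.mul_sum]
  refine Finset.sum_congr rfl fun i hi => ?_
  rw [← hcard, Finset.sum_congr rfl fun j hj => hcc j hj i hi, Finset.sum_const, smul_eq_mul]
  push_cast
  ring

/-- The indices of the values larger than `θ`. -/
noncomputable def above (θ : ℝ≥0) {n : ℕ} (x : Fin n → ℝ≥0) : Finset (Fin n) :=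
  Finset.univ.filter fun i => θ < x i

theorem sum_above_eq (θ : ℝ≥0) {n : ℕ} (x : Fin n → ℝ≥0) :
    ∑ i ∈ above θ x, x i = (above θ x).card * θ + ∑ i, (x i - θ) := by
  have h1 : ∑ i, (x i - θ) = ∑ i ∈ above θ x, (x i - θ) := by
    refine (Finset.sum_subset (Finset.subset_univ _) fun i _ hi => ?_).symm
    simp only [above, Finset.mem_filter, Finset.mem_univ, true_and, not_lt] at hi
    exact tsub_eq_zero_of_le hi
  rw [h1, ← nsmul_eq_mul, ← Finset.sum_const, ← Finset.sum_add_distrib]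
  refine Finset.sum_congr rfl fun i hi => (add_tsub_cancel_of_le ?_).symm
  exact (Finset.mem_filter.1 hi).2.le

/-- In a uniformly random order, the expected reward of a threshold that is exceeded is at least
the mean of the values above it. -/
theorem mul_mean_le_sum_reward (γ θ : ℝ≥0) {n : ℕ} (hn : 0 < n) (x : Fin n → ℝ≥0)
    (hx : (above θ x).Nonempty) :
    (n ! : ℝ≥0) * (θ + ∑ i, (x i - θ) * ((above θ x).card : ℝ≥0)⁻¹) ≤
      ∑ π : Equiv.Perm (Fin n), reward γ (x ∘ π) (firstAbove θ hn (x ∘ π)) := by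
  have hk : ∀ π : Equiv.Perm (Fin n), ∃ k : Fin n, (k : ℕ) = firstAbove θ hn (x ∘ π) ∧
      (θ : ℝ≥0∞) < ((x ∘ π) k : ℝ≥0∞) := by
    intro π
    obtain ⟨i, hi⟩ := hx
    refine exists_firstAbove_eq _ hn ⟨π.symm i, ?_⟩
    simpa [above] using hi
  choose k hk1 hk2 using hk
  have hmem : ∀ i, i ∈ above θ x ↔ θ < x i := by simp [above]
  have huni := card_mul_sum_perm_of_swap (above θ x) (fun π => π (k π))
    (fun π => by simpa [hmem] using hk2 π) (by
      intro i hi j hj π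
      -- Exchanging two values that both exceed `θ` leaves the set of positions above `θ` unchanged,
      -- hence also the stopping step.
      have : k (Equiv.swap i j * π) = k π := by
        apply Fin.ext
        rw [hk1, hk1]
        refine firstAbove_congr_of_iff _ hn fun l => ?_
        simp only [Function.comp, Equiv.Perm.mul_apply, ENNReal.coe_lt_coe]
        rw [hmem] at hi hj
        rcases eq_or_ne (π l) i with h | h
        · simp [h, hi, hj]
        rcases eq_or_ne (π l) j with h' | h'
        · simp [h', hi, hj]
        · rw [Equiv.swap_apply_of_ne_of_ne h h']
      simp [this]) x
  have hcard : ((above θ x).card : ℝ≥0) ≠ 0 := by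
    exact_mod_cast hx.card_pos.ne'
  have hle : ∑ π : Equiv.Perm (Fin n), x (π (k π)) ≤
      ∑ π : Equiv.Perm (Fin n), reward γ (x ∘ π) (firstAbove θ hn (x ∘ π)) := by
    refine Finset.sum_le_sum fun π _ => ?_
    rw [← hk1 π]
    exact le_reward γ (x ∘ π) (k π)
  refine le_trans (le_of_eq ?_) hle
  apply mul_left_cancel₀ hcard
  rw [huni, sum_above_eq, ← Finset.sum_mul]
  field_simp

end Pathwise

/-! ### The constant `p` and the one-variable inequalities it satisfies -/

section RejectProb

open Real

/-- The difference `g` of the two sides vanishes at `1/e` and at `1`. The numerator of `g'` factors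
as `(q - 1)(q - (e - 2)²)`, so `g` increases up to `(e - 2)²` and decreases from there to `1`; hence
`g ≥ 0` in between. -/
theorem mul_neg_log_le {p : ℝ} (hp : 1 / exp 1 ≤ p) (hp1 : p ≤ 1) :
    -log p ≤ (1 - p) * (exp 1 - 1) / (exp 1 - 2 + p) := by
  have he : 2.7 < exp 1 := by linarith [exp_one_gt_d9]
  have he' : exp 1 < 2.72 := by linarith [exp_one_lt_d9]
  have hpos : 0 < 1 / exp 1 := by positivity
  set g : ℝ → ℝ := fun p => (1 - p) * (exp 1 - 1) / (exp 1 - 2 + p) + log p with hg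
  have hder : ∀ q, 0 < q → HasDerivAt g
      ((q - 1) * (q - (exp 1 - 2) ^ 2) / (q * (exp 1 - 2 + q) ^ 2)) q := by
    intro q hq
    have hd : exp 1 - 2 + q ≠ 0 := by linarith
    have h := (((((hasDerivAt_id q).const_sub 1).mul_const (exp 1 - 1)).div
      ((hasDerivAt_id q).const_add (exp 1 - 2)) hd)).add (hasDerivAt_log hq.ne')
    refine h.congr_deriv ?_
    simp only [id]
    field_simp
    ring
  have hcont : ∀ s ⊆ Set.Ioi (0 : ℝ), ContinuousOn g s := fun s hs q hq =>
    (hder q (hs hq)).continuousAt.continuousWithinAt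
  have hm1 : 0 < (exp 1 - 2) ^ 2 := by nlinarith
  have hm2 : (exp 1 - 2) ^ 2 < 1 := by nlinarith
  have hg1 : g 1 = 0 := by simp [hg]
  have hge : g (1 / exp 1) = 0 := by
    simp only [hg, one_div, log_inv, log_exp]
    have : exp 1 - 2 + (exp 1)⁻¹ ≠ 0 := by
      have : 0 < (exp 1)⁻¹ := by positivity
      linarith
    have h2 : exp 1 * (exp 1 - 2) + 1 ≠ 0 := by nlinarith
    field_simp
    ring
  suffices 0 ≤ g p by
    simp only [hg] at this
    linarith
  rcases le_total p ((exp 1 - 2) ^ 2) with h | h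
  · have hmono : MonotoneOn g (Set.Icc (1 / exp 1) ((exp 1 - 2) ^ 2)) := by
      refine monotoneOn_of_deriv_nonneg (convex_Icc _ _)
        (hcont _ fun q hq => lt_of_lt_of_le hpos hq.1)
        (fun q hq => ?_) fun q hq => ?_
      all_goals
        rw [interior_Icc] at hq
        have hq0 : 0 < q := hpos.trans hq.1
      · exact (hder q hq0).differentiableAt.differentiableWithinAt
      · rw [(hder q hq0).deriv]
        refine div_nonneg (mul_nonneg_of_nonpos_of_nonpos ?_ ?_) (by positivity)
        · linarith [hq.2]
        · linarith [hq.2]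
    rw [← hge]
    exact hmono ⟨le_rfl, hp.trans h⟩ ⟨hp, h⟩ hp
  · have hanti : AntitoneOn g (Set.Icc ((exp 1 - 2) ^ 2) 1) := by
      refine antitoneOn_of_deriv_nonpos (convex_Icc _ _)
        (hcont _ fun q hq => lt_of_lt_of_le hm1 hq.1)
        (fun q hq => ?_) fun q hq => ?_
      all_goals
        rw [interior_Icc] at hq
        have hq0 : 0 < q := hm1.trans hq.1
      · exact (hder q hq0).differentiableAt.differentiableWithinAt
      · rw [(hder q hq0).deriv]
        refine div_nonpos_of_nonpos_of_nonneg (mul_nonpos_of_nonpos_of_nonneg ?_ ?_)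
          (by positivity)
        · linarith [hq.2]
        · linarith [hq.1]
    rw [← hg1]
    exact hanti ⟨h, hp1⟩ ⟨hm2.le, le_rfl⟩ hp1

theorem rejectProb_denom_pos {γ : ℝ≥0} (hγ : γ ≤ 1) :
    0 < 1 - (1 - 1 / exp 1) * (γ : ℝ) := by
  have h1 : (γ : ℝ) ≤ 1 := by exact_mod_cast hγ
  have h3 : 0 < 1 / exp 1 := by positivity
  have h4 : 1 / exp 1 < 1 := by
    rw [div_lt_one (exp_pos 1)]
    linarith [exp_one_gt_d9]
  nlinarith

theorem inv_exp_le_rejectProb {γ : ℝ≥0} (hγ : γ ≤ 1) : 1 / exp 1 ≤ rejectProb γ := by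
  have h4 : 1 / exp 1 < 1 := by
    rw [div_lt_one (exp_pos 1)]
    linarith [exp_one_gt_d9]
  unfold rejectProb
  rw [le_div_iff₀ (rejectProb_denom_pos hγ)]
  have : 0 ≤ (1 - 1 / exp 1) * (γ : ℝ) := mul_nonneg (by linarith) γ.2
  have h3 : 0 < 1 / exp 1 := by positivity
  nlinarith

theorem rejectProb_pos {γ : ℝ≥0} (hγ : γ ≤ 1) : 0 < rejectProb γ :=
  lt_of_lt_of_le (by positivity) (inv_exp_le_rejectProb hγ)

theorem rejectProb_lt_one {γ : ℝ≥0} (hγ : γ < 1) : rejectProb γ < 1 := by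
  have h1 : (γ : ℝ) < 1 := by exact_mod_cast hγ
  have h4 : 1 / exp 1 < 1 := by
    rw [div_lt_one (exp_pos 1)]
    linarith [exp_one_gt_d9]
  unfold rejectProb
  rw [div_lt_one (rejectProb_denom_pos hγ.le)]
  nlinarith

theorem rejectProb_one : rejectProb 1 = 1 := by
  simp [rejectProb]

theorem ratio_eq_one_sub (γ : ℝ≥0) :
    1 - ((1 - (γ : ℝ)) / exp 1) / (1 - (1 - 1 / exp 1) * (γ : ℝ)) =
      1 - (1 - (γ : ℝ)) * rejectProb γ := by
  unfold rejectProb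
  ring

theorem ratio_le_div_neg_log {γ : ℝ≥0} (hγ : γ < 1) :
    1 - (1 - (γ : ℝ)) * rejectProb γ ≤ (1 - rejectProb γ) / -log (rejectProb γ) := by
  have hp := rejectProb_pos hγ.le
  have hp1 := rejectProb_lt_one hγ
  have he : 2.7 < exp 1 := by linarith [exp_one_gt_d9]
  have hlog : 0 < -log (rejectProb γ) := by linarith [log_neg hp hp1]
  have h := mul_neg_log_le (inv_exp_le_rejectProb hγ.le) hp1.le
  rw [le_div_iff₀ (by linarith)] at h
  rw [le_div_iff₀ hlog]
  -- The definition of `p` cleared of denominators; it eliminates `γ` and turns the ratio into `(e -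
  -- 2 + p) / (e - 1)`.
  have hrel : (1 - (γ : ℝ)) * rejectProb γ * (exp 1 - 1) = 1 - rejectProb γ := by
    have hr : rejectProb γ * (exp 1 - (exp 1 - 1) * (γ : ℝ)) = 1 := by
      have hd := (rejectProb_denom_pos hγ.le).ne'
      have h1 : exp 1 - (exp 1 - 1) * (γ : ℝ) = exp 1 * (1 - (1 - 1 / exp 1) * (γ : ℝ)) := by
        field_simp
      rw [h1, rejectProb, div_mul_eq_mul_div, div_eq_one_iff_eq hd, ← mul_assoc,
        one_div_mul_cancel (exp_pos 1).ne', one_mul]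
    linear_combination hr
  have : 1 - (1 - (γ : ℝ)) * rejectProb γ = (exp 1 - 2 + rejectProb γ) / (exp 1 - 1) := by
    rw [eq_div_iff (by linarith), sub_mul, hrel]
    ring
  rw [this, div_mul_eq_mul_div, div_le_iff₀ (by linarith)]
  linarith

theorem lintegral_rpow_const_Ioc {p : ℝ} (hp : 0 < p) (hp1 : p < 1) :
    ∫⁻ t in Set.Ioc (0 : ℝ) 1, ENNReal.ofReal (p ^ t) = ENNReal.ofReal ((1 - p) / -log p) := by
  have hlog : log p ≠ 0 := (log_neg hp hp1).ne
  have hcont : Continuous fun t : ℝ => p ^ t := continuous_const_rpow hp.ne'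
  rw [← ofReal_integral_eq_lintegral_ofReal (hcont.integrableOn_Ioc)
    (ae_of_all _ fun t => (rpow_pos_of_pos hp t).le),
    ← intervalIntegral.integral_of_le zero_le_one]
  congr 1
  have hd : ∀ t ∈ Set.uIcc (0 : ℝ) 1, HasDerivAt (fun t : ℝ => p ^ t / log p) (p ^ t) t := by
    intro t _
    refine ((hasStrictDerivAt_const_rpow hp t).hasDerivAt.div_const _).congr_deriv ?_
    field_simp
  rw [intervalIntegral.integral_eq_sub_of_hasDerivAt hd (hcont.intervalIntegrable _ _)]
  simp only [rpow_one, rpow_zero]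
  field_simp
  ring

theorem lintegral_one_sub_pow_Ioc (k : ℕ) :
    ∫⁻ t in Set.Ioc (0 : ℝ) 1, ENNReal.ofReal (1 - t) ^ k =
      (((k + 1 : ℕ) : ℝ≥0)⁻¹ : ℝ≥0) := by
  have hcont : Continuous fun t : ℝ => (1 - t) ^ k := by fun_prop
  have h1 : ∫⁻ t in Set.Ioc (0 : ℝ) 1, ENNReal.ofReal (1 - t) ^ k =
      ∫⁻ t in Set.Ioc (0 : ℝ) 1, ENNReal.ofReal ((1 - t) ^ k) := by
    refine setLIntegral_congr_fun measurableSet_Ioc fun t ht => ?_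
    exact (ENNReal.ofReal_pow (by linarith [ht.2]) k).symm
  rw [h1, ← ofReal_integral_eq_lintegral_ofReal (hcont.integrableOn_Ioc) ?_,
    ← intervalIntegral.integral_of_le zero_le_one,
    intervalIntegral.integral_comp_sub_left (fun t => t ^ k) 1, integral_pow]
  · rw [← ENNReal.ofReal_coe_nnreal]
    congr 1
    simp
  · refine (ae_restrict_iff' measurableSet_Ioc).2 (ae_of_all _ fun t ht => ?_)
    exact pow_nonneg (by linarith [ht.2]) k

end RejectProb

/-! ### Averaging the excesses over independent values -/

section Integration

/-- The integral equals `1 - t + t q` with `q = μ (Iic θ)`, the weighted arithmetic mean of `1` and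
`q`; `q^t` is the geometric one. -/
theorem rpow_le_lintegral_ite (μ : Measure ℝ≥0) [IsProbabilityMeasure μ] (θ : ℝ≥0) {t : ℝ}
    (ht : 0 ≤ t) (ht1 : t ≤ 1) :
    ENNReal.ofReal (μ.real (Set.Iic θ) ^ t) ≤
      ∫⁻ y, (if θ < y then ENNReal.ofReal (1 - t) else 1) ∂μ := by
  have h : ∀ y, (if θ < y then ENNReal.ofReal (1 - t) else 1) =
      ENNReal.ofReal (1 - t) + (Set.Iic θ).indicator (fun _ => ENNReal.ofReal t) y := by
    intro y
    by_cases hy : θ < y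
    · simp [hy]
    · rw [if_neg hy, Set.indicator_of_mem (by simpa using hy),
        ← ENNReal.ofReal_add (by linarith) ht]
      simp
  simp only [h]
  rw [lintegral_add_left measurable_const, lintegral_const, measure_univ, mul_one,
    lintegral_indicator_const measurableSet_Iic, ← ofReal_measureReal, ← ENNReal.ofReal_mul ht,
    ← ENNReal.ofReal_add (by linarith) (by positivity)]
  refine ENNReal.ofReal_le_ofReal ?_
  have := Real.geom_mean_le_arith_mean2_weighted (sub_nonneg.2 ht1) ht zero_le_one
    (measureReal_nonneg (μ := μ) (s := Set.Iic θ)) (by ring)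
  simpa using this

variable {n : ℕ} (F : Fin n → Measure ℝ≥0) [∀ i, IsProbabilityMeasure (F i)]

theorem lintegral_pi_prod {f : Fin n → ℝ≥0 → ℝ≥0∞} (hf : ∀ i, Measurable (f i)) :
    ∫⁻ x, ∏ i, f i (x i) ∂Measure.pi F = ∏ i, ∫⁻ y, f i y ∂F i := by
  have hind : ProbabilityTheory.iIndepFun (fun i (x : Fin n → ℝ≥0) => f i (x i))
      (Measure.pi F) := ProbabilityTheory.iIndepFun_pi fun i => (hf i).aemeasurable
  rw [ProbabilityTheory.lintegral_prod_eq_prod_lintegral_of_indepFun Finset.univ _ hind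
    fun i => (hf i).comp (measurable_pi_apply i)]
  exact Finset.prod_congr rfl fun i _ => (measurePreserving_eval F i).lintegral_comp (hf i)

theorem pi_maxValue_le (θ : ℝ≥0) :
    (Measure.pi F).real {x | (maxValue x : ℝ≥0∞) ≤ θ} = ∏ i, (F i).real (Set.Iic θ) := by
  have h : {x : Fin n → ℝ≥0 | (maxValue x : ℝ≥0∞) ≤ θ} = Set.pi Set.univ fun _ => Set.Iic θ := by
    ext x
    rw [Set.mem_ofPred_eq, maxValue_le_iff]
    simp only [ENNReal.coe_le_coe, Set.mem_univ_pi, Set.mem_Iic]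
  rw [h, Measure.real, Measure.pi_pi, ENNReal.toReal_prod]
  rfl

theorem measurable_card_above (θ : ℝ≥0) :
    Measurable fun x : Fin n → ℝ≥0 => ((above θ x).card : ℝ≥0) := by
  simp only [above, Finset.card_filter, Nat.cast_sum]
  refine Finset.measurable_fun_sum _ fun i _ => ?_
  refine (measurable_from_top (f := fun k : ℕ => (k : ℝ≥0))).comp ?_
  exact Measurable.ite (measurableSet_lt measurable_const (measurable_pi_apply i))
    measurable_const measurable_const

/-- The factor of the coordinate `j` when the value `i` arrives at time `t`: the excess of the
value `i` over `θ`, and for `j ≠ i` the probability of not arriving above `θ` before `t`. -/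
noncomputable def arrivalFactor (θ : ℝ≥0) (i : Fin n) (t : ℝ) (j : Fin n) (y : ℝ≥0) : ℝ≥0∞ :=
  if j = i then ((y - θ : ℝ≥0) : ℝ≥0∞) else if θ < y then ENNReal.ofReal (1 - t) else 1

theorem measurable_arrivalFactor (θ : ℝ≥0) (i j : Fin n) :
    Measurable fun q : ℝ × ℝ≥0 => arrivalFactor θ i q.1 j q.2 := by
  unfold arrivalFactor
  split_ifs
  · fun_prop
  · exact Measurable.ite (measurableSet_lt measurable_const measurable_snd) (by fun_prop)
      measurable_const

theorem lintegral_prod_arrivalFactor (θ : ℝ≥0) (i : Fin n) (x : Fin n → ℝ≥0) :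
    ∫⁻ t in Set.Ioc (0 : ℝ) 1, ∏ j, arrivalFactor θ i t j (x j) =
      ((x i - θ : ℝ≥0) : ℝ≥0∞) * ((((above θ x).card : ℝ≥0)⁻¹ : ℝ≥0) : ℝ≥0∞) := by
  have hprod : ∀ t : ℝ, ∏ j, arrivalFactor θ i t j (x j) = ((x i - θ : ℝ≥0) : ℝ≥0∞) *
      ENNReal.ofReal (1 - t) ^ ((above θ x).erase i).card := by
    intro t
    rw [← Finset.mul_prod_erase _ _ (Finset.mem_univ i)]
    congr 1
    · simp [arrivalFactor]
    · have : (above θ x).erase i = (Finset.univ.erase i).filter fun j => θ < x j := by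
        ext j
        simp [above]
      rw [this, ← Finset.prod_const, Finset.prod_filter]
      refine Finset.prod_congr rfl fun j hj => ?_
      simp [arrivalFactor, Finset.ne_of_mem_erase hj]
  simp only [hprod]
  rw [lintegral_const_mul' _ _ ENNReal.coe_ne_top, lintegral_one_sub_pow_Ioc]
  -- If `x i` is above `θ`, removing `i` lowers the count by one, matching `∫ (1 - t)^k = 1/(k +
  -- 1)`. Otherwise the excess is zero, and the inverse of a zero count is harmless.
  by_cases h : θ < x i
  · rw [Finset.card_erase_add_one (by simpa [above] using h)]
  · rw [tsub_eq_zero_of_le (not_lt.1 h)]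
    simp

theorem mul_lintegral_rpow_le (θ : ℝ≥0) (i : Fin n) :
    (∫⁻ y, ((y - θ : ℝ≥0) : ℝ≥0∞) ∂F i) * (∫⁻ t in Set.Ioc (0 : ℝ) 1,
        ENNReal.ofReal ((∏ j, (F j).real (Set.Iic θ)) ^ t)) ≤
      ∫⁻ x, ((x i - θ : ℝ≥0) : ℝ≥0∞) * ((((above θ x).card : ℝ≥0)⁻¹ : ℝ≥0) : ℝ≥0∞)
        ∂Measure.pi F := by
  simp only [← lintegral_prod_arrivalFactor]
  rw [lintegral_lintegral_swap]
  swap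
  · refine Measurable.aemeasurable ?_
    refine Finset.measurable_fun_prod _ fun j _ => ?_
    exact (measurable_arrivalFactor θ i j).comp
      (measurable_snd.prodMk ((measurable_pi_apply j).comp measurable_fst))
  refine (lintegral_const_mul_le _ _).trans ?_
  refine setLIntegral_mono' measurableSet_Ioc fun t ht => ?_
  have hmeas : ∀ j, Measurable (arrivalFactor θ i t j) := fun j =>
    (measurable_arrivalFactor θ i j).comp (measurable_const.prodMk measurable_id)
  rw [lintegral_pi_prod F hmeas, ← Finset.mul_prod_erase _
    (fun j => ∫⁻ y, arrivalFactor θ i t j y ∂F j) (Finset.mem_univ i)]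
  refine mul_le_mul' (by simp [arrivalFactor]) ?_
  have h0 : ∀ j, 0 ≤ (F j).real (Set.Iic θ) := fun j => measureReal_nonneg
  calc ENNReal.ofReal ((∏ j, (F j).real (Set.Iic θ)) ^ t)
      ≤ ENNReal.ofReal (∏ j ∈ Finset.univ.erase i, (F j).real (Set.Iic θ) ^ t) := by
        refine ENNReal.ofReal_le_ofReal ?_
        rw [Real.finsetProd_rpow _ _ fun j _ => h0 j]
        refine Real.rpow_le_rpow (Finset.prod_nonneg fun j _ => h0 j) ?_ ht.1.le
        rw [← Finset.mul_prod_erase _ _ (Finset.mem_univ i)]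
        -- Restoring the missing factor of index `i`, which is at most `1`, only lowers the product.
        exact mul_le_of_le_one_left (Finset.prod_nonneg fun j _ => h0 j) measureReal_le_one
    _ = ∏ j ∈ Finset.univ.erase i, ENNReal.ofReal ((F j).real (Set.Iic θ) ^ t) :=
        ENNReal.ofReal_prod_of_nonneg fun j _ => Real.rpow_nonneg (h0 j) t
    _ ≤ _ := by
        refine Finset.prod_le_prod' fun j hj => ?_
        simp only [arrivalFactor, Finset.ne_of_mem_erase hj, if_false]
        exact rpow_le_lintegral_ite (F j) θ ht.1.le ht.2

end Integration

/-! ### Existence of the threshold for atomless distributions -/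

section Continuous

theorem isProbabilityMeasure_law (I : Instance) : IsProbabilityMeasure I.law := by
  have := I.prob
  unfold Instance.law
  infer_instance

/-- Dominated convergence: for fixed `a`, the indicator of `a ≤ η` is continuous in `η` at `θ`
unless `a = θ`, a null event. -/
theorem continuous_measureReal_Iic (μ : Measure ℝ≥0) [IsFiniteMeasure μ]
    (hμ : ∀ a, μ {a} = 0) : Continuous fun θ : ℝ≥0 => μ.real (Set.Iic θ) := by
  have h : ∀ θ : ℝ≥0, μ.real (Set.Iic θ) = ∫ a, (Set.Iic θ).indicator (fun _ => (1 : ℝ)) a ∂μ :=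
    fun θ => by rw [integral_indicator_const _ measurableSet_Iic]; simp
  simp only [h]
  refine continuous_iff_continuousAt.2 fun θ => ?_
  refine continuousAt_of_dominated (bound := fun _ => 1) (Filter.Eventually.of_forall fun η => ?_)
    (Filter.Eventually.of_forall fun η => ae_of_all _ fun a => ?_) (integrable_const _) ?_
  · exact (measurable_const.indicator measurableSet_Iic).aestronglyMeasurable
  · exact (norm_indicator_le_norm_self _ _).trans (by simp)
  · have hne : ∀ᵐ a ∂μ, a ≠ θ := by
      rw [ae_iff]
      simpa using hμ θ
    filter_upwards [hne] with a ha
    rcases lt_or_gt_of_ne ha with h | h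
    · refine (continuousAt_const (y := (1 : ℝ))).congr ?_
      filter_upwards [lt_mem_nhds h] with η hη
      simp [hη.le]
    · refine (continuousAt_const (y := (0 : ℝ))).congr ?_
      filter_upwards [gt_mem_nhds h] with η hη
      simp [hη]

theorem exists_probMaxLE_eq {γ : ℝ≥0} (hγ : γ ≤ 1) (I : Instance) (hI : I.IsContinuous) :
    ∃ θ : ℝ≥0∞, probMaxLE I θ = rejectProb γ := by
  have := I.prob
  have := isProbabilityMeasure_law I
  rcases hγ.eq_or_lt with rfl | hγ1
  -- For `γ = 1` the target is `1`, which unbounded values attain only at the infinite threshold.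
  -- For `γ < 1` the intermediate value theorem applies.
  · exact ⟨⊤, by simp [probMaxLE, rejectProb_one]⟩
  have hG : ∀ θ : ℝ≥0, probMaxLE I θ = ∏ i, (I.F i).real (Set.Iic θ) := pi_maxValue_le I.F
  have hcont : Continuous fun θ : ℝ≥0 => probMaxLE I θ := by
    simp only [hG]
    exact continuous_finsetProd _ fun i _ => continuous_measureReal_Iic _ (hI i)
  have hzero : probMaxLE I (0 : ℝ≥0) = 0 := by
    rw [hG]
    refine Finset.prod_eq_zero (Finset.mem_univ ⟨0, I.pos⟩) ?_
    have : Set.Iic (0 : ℝ≥0) = {0} := by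
      ext
      simp
    rw [this, Measure.real, hI]
    rfl
  have htop : Filter.Tendsto (fun θ : ℝ≥0 => probMaxLE I θ) Filter.atTop (nhds 1) := by
    simp only [hG]
    rw [← Finset.prod_const_one (s := (Finset.univ : Finset (Fin I.n)))]
    refine tendsto_finsetProd _ fun i _ => ?_
    have := (ENNReal.tendsto_toReal (measure_ne_top (I.F i) Set.univ)).comp
      (tendsto_measure_Iic_atTop (I.F i))
    simpa [Measure.real, Function.comp_def] using this
  obtain ⟨b, hb⟩ := (htop.eventually (lt_mem_nhds (rejectProb_lt_one hγ1))).exists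
  obtain ⟨θ, hθ⟩ := mem_range_of_exists_le_of_exists_ge hcont
    ⟨0, hzero.le.trans (rejectProb_pos hγ).le⟩ ⟨b, hb.le⟩
  exact ⟨θ, hθ⟩

end Continuous

/-! ### Comparison of the reward with the expected maximum -/

section Main

theorem expectedOpt_ne_top (I : Instance) : expectedOpt I ≠ ∞ := by
  have := I.prob
  have h : expectedOpt I ≤ ∑ i, ∫⁻ y, (y : ℝ≥0∞) ∂I.F i := by
    calc expectedOpt I ≤ ∫⁻ x, ∑ i, (x i : ℝ≥0∞) ∂I.law := by
          refine lintegral_mono fun x => maxValue_le_iff.2 fun i => ?_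
          exact Finset.single_le_sum (f := fun i => (x i : ℝ≥0∞)) (fun _ _ => zero_le)
            (Finset.mem_univ i)
      _ = ∑ i, ∫⁻ x, (x i : ℝ≥0∞) ∂I.law := lintegral_finsetSum _ fun i _ => by fun_prop
      _ = _ := Finset.sum_congr rfl fun i _ =>
          (measurePreserving_eval I.F i).lintegral_comp measurable_coe_nnreal_ennreal
  exact ne_top_of_le_ne_top (ENNReal.sum_ne_top.2 fun i _ => I.finiteMean i) h

theorem expectedReward_eq_lintegral (γ : ℝ≥0) (θ : Instance → ℝ≥0∞) (I : Instance) :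
    expectedReward γ (singleThreshold θ) I = ∫⁻ x, (((∑ π : Equiv.Perm (Fin I.n),
      reward γ (x ∘ π) (firstAbove (θ I) I.pos (x ∘ π)) : ℝ≥0) : ℝ≥0∞) / (I.n ! : ℝ≥0∞))
        ∂I.law := by
  have hm : ∀ π : Equiv.Perm (Fin I.n), Measurable fun x : Fin I.n → ℝ≥0 =>
      (reward γ (x ∘ π) (firstAbove (θ I) I.pos (x ∘ π)) : ℝ≥0∞) := fun π =>
    ((measurable_reward γ (measurable_firstAbove (θ I) I.pos)).comp
      (measurable_pi_lambda _ fun i => measurable_pi_apply (π i))).coe_nnreal_ennreal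
  simp only [expectedReward, singleThreshold, ENNReal.ofNNReal_finsetSum, div_eq_mul_inv]
  rw [lintegral_mul_const _ (Finset.measurable_fun_sum _ fun π _ => hm π),
    lintegral_finsetSum _ fun π _ => hm π]

theorem factorial_mul_div (n : ℕ) (a : ℝ≥0) :
    (((n ! : ℝ≥0) * a : ℝ≥0) : ℝ≥0∞) / (n ! : ℝ≥0∞) = a := by
  rw [ENNReal.coe_mul, ENNReal.coe_natCast, mul_comm]
  exact ENNReal.mul_div_cancel_right (by exact_mod_cast n.factorial_ne_zero)
    (ENNReal.natCast_ne_top _)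

theorem sum_reward_of_forall_le (γ : ℝ≥0) {θ : ℝ≥0∞} {n : ℕ} (hn : 0 < n) {x : Fin n → ℝ≥0}
    (hx : (maxValue x : ℝ≥0∞) ≤ θ) :
    ∑ π : Equiv.Perm (Fin n), reward γ (x ∘ π) (firstAbove θ hn (x ∘ π)) =
      (n ! : ℝ≥0) * (γ * maxValue x) := by
  rw [maxValue_le_iff] at hx
  have : ∀ π : Equiv.Perm (Fin n),
      reward γ (x ∘ π) (firstAbove θ hn (x ∘ π)) = γ * maxValue x := fun π => by
    rw [firstAbove_eq_of_forall_le θ hn (y := x ∘ π) fun i => hx (π i), reward_of_never, maxValue_comp_perm]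
  simp [this, Fintype.card_perm]

/-- Almost surely nothing is accepted, and full lookback then returns the maximum itself. -/
theorem expectedOpt_le_expectedReward_one (θ : Instance → ℝ≥0∞) (I : Instance)
    (h : probMaxLE I (θ I) = 1) :
    expectedOpt I ≤ expectedReward 1 (singleThreshold θ) I := by
  have := isProbabilityMeasure_law I
  have hE : MeasurableSet {x : Fin I.n → ℝ≥0 | (maxValue x : ℝ≥0∞) ≤ θ I} :=
    measurableSet_le measurable_maxValue.coe_nnreal_ennreal measurable_const
  have hae : ∀ᵐ x ∂I.law, (maxValue x : ℝ≥0∞) ≤ θ I := by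
    refine (prob_compl_eq_zero_iff hE).2 ?_
    rw [← ofReal_measureReal, show I.law.real _ = 1 from h, ENNReal.ofReal_one]
  rw [expectedReward_eq_lintegral]
  refine lintegral_mono_ae ?_
  filter_upwards [hae] with x hx
  rw [sum_reward_of_forall_le 1 I.pos hx, factorial_mul_div, one_mul]

/-- The excesses over `θ` dominate the part of the maximum above `θ`. -/
theorem expectedOpt_le (I : Instance) (θ : ℝ≥0) :
    expectedOpt I ≤ (∫⁻ x in {x | (maxValue x : ℝ≥0∞) ≤ θ}, (maxValue x : ℝ≥0∞) ∂I.law) +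
      θ * I.law {x | (maxValue x : ℝ≥0∞) ≤ θ}ᶜ + ∑ i, ∫⁻ y, ((y - θ : ℝ≥0) : ℝ≥0∞) ∂I.F i := by
  have := I.prob
  set E : Set (Fin I.n → ℝ≥0) := {x | (maxValue x : ℝ≥0∞) ≤ θ} with hEdef
  have hE : MeasurableSet E :=
    measurableSet_le measurable_maxValue.coe_nnreal_ennreal measurable_const
  have hM : Measurable fun x : Fin I.n → ℝ≥0 => (maxValue x : ℝ≥0∞) :=
    measurable_maxValue.coe_nnreal_ennreal
  have hsum : ∑ i, ∫⁻ y, ((y - θ : ℝ≥0) : ℝ≥0∞) ∂I.F i =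
      ∫⁻ x, ∑ i, ((x i - θ : ℝ≥0) : ℝ≥0∞) ∂I.law := by
    rw [lintegral_finsetSum _ fun i _ => by fun_prop]
    exact Finset.sum_congr rfl fun i _ =>
      ((measurePreserving_eval I.F i).lintegral_comp (by fun_prop)).symm
  rw [hsum, ← lintegral_indicator hE, ← lintegral_indicator_const hE.compl,
    ← lintegral_add_left (hM.indicator hE),
    ← lintegral_add_left ((hM.indicator hE).fun_add (measurable_const.indicator hE.compl))]
  refine lintegral_mono fun x => ?_
  by_cases hx : x ∈ E
  · rw [Set.indicator_of_mem hx, Set.indicator_of_notMem (by simpa using hx), add_zero]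
    exact le_self_add
  · rw [Set.indicator_of_notMem hx, Set.indicator_of_mem (by simpa using hx), zero_add]
    refine maxValue_le_iff.2 fun i => ?_
    calc (x i : ℝ≥0∞) ≤ ((θ + (x i - θ) : ℝ≥0) : ℝ≥0∞) := by
          exact_mod_cast le_add_tsub
      _ ≤ _ := by
          rw [ENNReal.coe_add]
          gcongr
          exact Finset.single_le_sum (f := fun i => ((x i - θ : ℝ≥0) : ℝ≥0∞))
            (fun _ _ => zero_le) (Finset.mem_univ i)

theorem le_expectedReward (γ : ℝ≥0) (τ : Instance → ℝ≥0∞) (I : Instance) {θ : ℝ≥0}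
    (hθ : τ I = θ) :
    γ * (∫⁻ x in {x | (maxValue x : ℝ≥0∞) ≤ θ}, (maxValue x : ℝ≥0∞) ∂I.law) +
      θ * I.law {x | (maxValue x : ℝ≥0∞) ≤ θ}ᶜ +
      ∑ i, ∫⁻ x, ((x i - θ : ℝ≥0) : ℝ≥0∞) * ((((above θ x).card : ℝ≥0)⁻¹ : ℝ≥0) : ℝ≥0∞) ∂I.law ≤
    expectedReward γ (singleThreshold τ) I := by
  set E : Set (Fin I.n → ℝ≥0) := {x | (maxValue x : ℝ≥0∞) ≤ θ} with hEdef
  have hE : MeasurableSet E :=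
    measurableSet_le measurable_maxValue.coe_nnreal_ennreal measurable_const
  have hM : Measurable fun x : Fin I.n → ℝ≥0 => (γ : ℝ≥0∞) * (maxValue x : ℝ≥0∞) :=
    measurable_maxValue.coe_nnreal_ennreal.const_mul _
  have hmeas : ∀ i, Measurable fun x : Fin I.n → ℝ≥0 =>
      ((x i - θ : ℝ≥0) : ℝ≥0∞) * ((((above θ x).card : ℝ≥0)⁻¹ : ℝ≥0) : ℝ≥0∞) := fun i => by
    have h : Measurable fun x : Fin I.n → ℝ≥0 => x i - θ := by fun_prop
    exact h.coe_nnreal_ennreal.mul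
      (measurable_card_above θ).inv.coe_nnreal_ennreal
  rw [expectedReward_eq_lintegral, hθ, ← lintegral_finsetSum _ fun i _ => hmeas i,
    ← lintegral_const_mul _ measurable_maxValue.coe_nnreal_ennreal,
    ← lintegral_indicator hE, ← lintegral_indicator_const hE.compl,
    ← lintegral_add_left (hM.indicator hE),
    ← lintegral_add_left ((hM.indicator hE).fun_add (measurable_const.indicator hE.compl))]
  refine lintegral_mono fun x => ?_
  by_cases hx : x ∈ E
  · have hle := maxValue_le_iff.1 (show (maxValue x : ℝ≥0∞) ≤ θ from hx)
    rw [Set.indicator_of_mem hx, Set.indicator_of_notMem (by simpa using hx), add_zero,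
      sum_reward_of_forall_le γ I.pos hx, factorial_mul_div, Finset.sum_eq_zero, add_zero,
      ENNReal.coe_mul]
    intro i _
    rw [tsub_eq_zero_of_le (ENNReal.coe_le_coe.1 (hle i))]
    simp
  · rw [Set.indicator_of_notMem hx, Set.indicator_of_mem (by simpa using hx), zero_add]
    have hne : (above θ x).Nonempty := by
      by_contra h
      apply hx
      rw [hEdef, Set.mem_ofPred_eq, maxValue_le_iff]
      intro i
      rw [Finset.not_nonempty_iff_eq_empty] at h
      have : i ∉ above θ x := by simp [h]
      simpa [above] using this
    calc _ = (((I.n ! : ℝ≥0) * (θ + ∑ i, (x i - θ) * ((above θ x).card : ℝ≥0)⁻¹) : ℝ≥0) : ℝ≥0∞) /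
          (I.n ! : ℝ≥0∞) := by
          rw [factorial_mul_div]
          push_cast
          rfl
      _ ≤ _ := by
          gcongr
          exact mul_mean_le_sum_reward γ θ I.pos x hne

theorem ratio_mul_expectedOpt_le {γ : ℝ≥0} (hγ : γ < 1) (τ : Instance → ℝ≥0∞) (I : Instance)
    (h : probMaxLE I (τ I) = rejectProb γ) :
    ENNReal.ofReal (1 - (1 - (γ : ℝ)) * rejectProb γ) * expectedOpt I ≤
      expectedReward γ (singleThreshold τ) I := by
  have := I.prob
  have := isProbabilityMeasure_law I
  have hp := rejectProb_pos hγ.le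
  have hp1 := rejectProb_lt_one hγ
  have hγ1 : (γ : ℝ) < 1 := by exact_mod_cast hγ
  -- An infinite threshold would give probability `1`, but `p < 1`.
  obtain ⟨θ, hθ⟩ : ∃ θ : ℝ≥0, τ I = θ := by
    refine ⟨(τ I).toNNReal, (ENNReal.coe_toNNReal fun htop => hp1.ne ?_).symm⟩
    rw [← h, htop]
    simp [probMaxLE]
  rw [hθ] at h
  set p := rejectProb γ
  have hE : MeasurableSet {x : Fin I.n → ℝ≥0 | (maxValue x : ℝ≥0∞) ≤ θ} :=
    measurableSet_le measurable_maxValue.coe_nnreal_ennreal measurable_const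
  have hprod : ∏ j, (I.F j).real (Set.Iic θ) = p := by
    rw [← pi_maxValue_le, ← h]
    rfl
  have hcompl : I.law {x | (maxValue x : ℝ≥0∞) ≤ θ}ᶜ = ENNReal.ofReal (1 - p) := by
    rw [← ofReal_measureReal, probReal_compl_eq_one_sub hE, ← h]
    rfl
  have hEp : I.law {x | (maxValue x : ℝ≥0∞) ≤ θ} = ENNReal.ofReal p := by
    rw [← ofReal_measureReal, ← h]
    rfl
  refine (mul_le_mul' le_rfl (expectedOpt_le I θ)).trans
    (le_trans ?_ (le_expectedReward γ τ I hθ))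
  rw [mul_add]
  refine add_le_add ?_ ?_
  · rw [hcompl]
    have hA : ∫⁻ x in {x | (maxValue x : ℝ≥0∞) ≤ θ}, (maxValue x : ℝ≥0∞) ∂I.law ≤
        θ * ENNReal.ofReal p := by
      rw [← hEp, ← setLIntegral_const]
      exact setLIntegral_mono' hE fun x hx => hx
    generalize (∫⁻ x in {x | (maxValue x : ℝ≥0∞) ≤ θ}, (maxValue x : ℝ≥0∞) ∂I.law) = A at hA ⊢
    have hAtop : A ≠ ∞ := ne_top_of_le_ne_top (by finiteness) hA
    lift A to ℝ≥0 using hAtop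
    rw [← ENNReal.ofReal_coe_nnreal (p := A), ← ENNReal.ofReal_coe_nnreal (p := θ)] at *
    rw [← ENNReal.ofReal_coe_nnreal (p := γ)]
    have hA0 : (0 : ℝ) ≤ A := A.2
    have hθ0 : (0 : ℝ) ≤ θ := θ.2
    have hγ0 : (0 : ℝ) ≤ γ := γ.2
    have h1p : 0 ≤ 1 - p := by linarith
    rw [← ENNReal.ofReal_mul hθ0, ENNReal.ofReal_le_ofReal_iff (by positivity)] at hA
    rw [← ENNReal.ofReal_mul hθ0, ← ENNReal.ofReal_mul hγ0,
      ← ENNReal.ofReal_add hA0 (by positivity), ← ENNReal.ofReal_add (by positivity)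
      (by positivity), ← ENNReal.ofReal_mul (by nlinarith)]
    refine ENNReal.ofReal_le_ofReal ?_
    -- The right side minus the left is exactly `(1 - p)(1 - γ)(θ p - A)`.
    have := mul_nonneg (mul_nonneg h1p (sub_nonneg.2 hγ1.le)) (sub_nonneg.2 hA)
    nlinarith
  · rw [Finset.mul_sum]
    refine Finset.sum_le_sum fun i _ => ?_
    have hi := mul_lintegral_rpow_le I.F θ i
    rw [hprod, lintegral_rpow_const_Ioc hp hp1, mul_comm] at hi
    exact (mul_le_mul' (ENNReal.ofReal_le_ofReal (ratio_le_div_neg_log hγ)) le_rfl).trans hi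

end Main

end LookbackProphet

theorem mainTheorem9 (γ : NNReal) (hγ : γ ≤ 1) :
    (∀ I : LookbackProphet.Instance, I.IsContinuous →
      ∃ θ : ENNReal, LookbackProphet.probMaxLE I θ = LookbackProphet.rejectProb γ) ∧
    (∀ (C : Set LookbackProphet.Instance) (θ : LookbackProphet.Instance → ENNReal),
      (∀ I ∈ C, LookbackProphet.probMaxLE I (θ I) = LookbackProphet.rejectProb γ) →
      ENNReal.ofReal
          (1 - ((1 - (γ : ℝ)) / Real.exp 1) / (1 - (1 - 1 / Real.exp 1) * (γ : ℝ))) ≤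
        LookbackProphet.competitiveRatio γ C (LookbackProphet.singleThreshold θ)) := by
  refine ⟨LookbackProphet.exists_probMaxLE_eq hγ, fun C θ hC => ?_⟩
  refine le_iInf₂ fun I hI => le_iInf fun hne => ?_
  rw [ENNReal.le_div_iff_mul_le (Or.inl hne) (Or.inl (LookbackProphet.expectedOpt_ne_top I)),
    LookbackProphet.ratio_eq_one_sub]
  have h := hC I hI
  rcases hγ.eq_or_lt with rfl | hγ1
  · rw [LookbackProphet.rejectProb_one] at h
    simpa using LookbackProphet.expectedOpt_le_expectedReward_one θ I h
  · exact LookbackProphet.ratio_mul_expectedOpt_le hγ1 θ I h
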